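/- Setting. Vectors of $\mathbb{R}^n$ are multiplied in the Clifford algebra $C\ell_n$ of $\mathbb{R}^n$, with $vw+wv=-2(v,w)$; thus a non-zero vector $v$ has the inverse $v^{-1}=-v/\|v\|^2\in\mathbb{R}^n$, and $vwv\in\mathbb{R}^n$ for $v,w\in\mathbb{R}^n$. For $C\ell_n$-valued $1$-forms, $(\alpha\wedge\beta)(X,Y)=\alpha(X)\beta(Y)-\alpha(Y)\beta(X)$. All maps are smooth. Let $(M,Q)$ be a polarised Riemann surface, i.e. a connected Riemann surface $M$ with a holomorphic quadratic differential $Q\not\equiv0$. For maps $f,f^c:M\to\mathbb{R}^n$, say that $f^c$ is a Christoffel transform of $f$ (with respect to $Q$) if $$\mathrm df\wedge\mathrm df^c=0,\qquad (\mathrm df,\mathrm df^c)^{2,0}=Q .$$ A conformal immersion $f:M\to\mathbb{R}^n$ is isothermic on $(M,Q)$ if it has a Christoffel transform. Maps $f,\hat f:M\to\mathbb{R}^n$ form a Darboux pair if they are non-constant, $g=\hat f-f$ has no zeros, and $\mathrm df\wedge g^{-1}\,\mathrm d\hat f\,g^{-1}=0$. Given $f$ with Christoffel transform $f^c$ and $r\in\mathbb{R}\setminus\{0\}$,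 write $\hat f=f+g=\mathcal{D}_rf$ if $g:M\to\mathbb{R}^n$ has no zeros and solves the Riccati equation $$\mathrm dg=r\,g\,\mathrm df^c\,g-\mathrm df .$$ In the same way, $f^c+h=\mathcal{D}_rf^c$ means that $h$ has no zeros and $\mathrm dh=r\,h\,\mathrm df\,h-\mathrm df^c$. Theorem (Christoffel and Darboux transforms commute). Let $f:(M,Q)\to\mathbb{R}^n$ be isothermic with Christoffel transform $f^c$, let $r\in\mathbb{R}\setminus\{0\}$ and let $\hat f=f+g=\mathcal{D}_rf$. Then: (1) $f$ is a Christoffel transform of $f^c$, and $f^c$ is a conformal immersion away from the zeros of $Q$. (2) $f^c+(rg)^{-1}=\mathcal{D}_rf^c$, and $(f^c,\,f^c+(rg)^{-1})$ is a Darboux pair. (3) $\hat f$ is a conformal immersion away from the zeros of $Q$, and a map $F:M\to\mathbb{R}^n$ is a Christoffel transform of $\hat f$ if and only if $F=f^c+(rg)^{-1}+k$ for some constant $k\in\mathbb{R}^n$. That is, $\hat f$ has a Christoffel transform $\hat f^c$, unique up to translation, and it coincides up to translation with $f^c+(rg)^{-1}=\mathcal{D}_rf^c$. (4) $\mathrm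 d\hat f^c=r^{-1}g^{-1}\,\mathrm df\,g^{-1}$. -/

import Mathlib

open scoped Manifold ContDiff

noncomputable section

namespace Isothermic

/-! ### Euclidean space and its Clifford algebra -/

/-- `ℝⁿ` with its Euclidean inner product. -/
abbrev E (n : ℕ) : Type := EuclideanSpace ℝ (Fin n)

/-- The quadratic form `x ↦ -(x, x)` on `ℝⁿ`. -/
def negQ (n : ℕ) : QuadraticForm ℝ (E n) :=
  -(LinearMap.BilinMap.toQuadraticMap (innerₗ (E n)))

theorem negQ_apply {n : ℕ} (x : E n) : negQ n x = -‖x‖ ^ 2 := by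
  simp [negQ]

/-- The Clifford algebra of `ℝⁿ`, with the convention `v w + w v = -2 (v, w)`. -/
abbrev Cl (n : ℕ) : Type := CliffordAlgebra (negQ n)

/-- The inclusion `ℝⁿ → Cl n`. -/
abbrev inc {n : ℕ} : E n →ₗ[ℝ] Cl n := CliffordAlgebra.ι (negQ n)

/-- The Clifford inverse of a vector, which is again a vector: `v⁻¹ = -v / ‖v‖²` for `v ≠ 0`
(and `0` for `v = 0`). -/
def vinv {n : ℕ} (v : E n) : E n := -((‖v‖ ^ 2)⁻¹ • v)

theorem inc_mul_inc_vinv {n : ℕ} {v : E n} (hv : v ≠ 0) : inc v * inc (vinv v) = 1 := by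
  have h : ‖v‖ ^ 2 ≠ 0 := by simpa using hv
  simp only [vinv, map_neg, map_smul, mul_neg, mul_smul_comm, CliffordAlgebra.ι_sq_scalar,
    negQ_apply, Algebra.algebraMap_eq_smul_one, smul_neg, neg_neg, smul_smul,
    inv_mul_cancel₀ h, one_smul]

theorem inc_vinv_mul_inc {n : ℕ} {v : E n} (hv : v ≠ 0) : inc (vinv v) * inc v = 1 := by
  have h : ‖v‖ ^ 2 ≠ 0 := by simpa using hv
  simp only [vinv, map_neg, map_smul, neg_mul, smul_mul_assoc, CliffordAlgebra.ι_sq_scalar,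
    negQ_apply, Algebra.algebraMap_eq_smul_one, smul_neg, neg_neg, smul_smul,
    inv_mul_cancel₀ h, one_smul]

/-! ### Differential forms on a Riemann surface

Throughout, a Riemann surface is a connected complex analytic manifold modelled on `ℂ`. -/

section Forms

variable {M : Type*} [TopologicalSpace M] [ChartedSpace ℂ M] {n : ℕ}

/-- The real tangent space of `M` at `p` (a copy of `ℂ`, through the preferred chart at `p`). -/
abbrev T (p : M) : Type := TangentSpace 𝓘(ℝ, ℂ) p

/-- The complex tangent line of `M` at `p`: the same set as `T p`, with its complex structure. -/
abbrev Tc (p : M) : Type := TangentSpace 𝓘(ℂ, ℂ) p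

/-- A real tangent vector, seen as an element of the complex tangent line. -/
def toTc {p : M} (v : T p) : Tc p := v

/-- The complex structure of the tangent spaces: multiplication by `i`. -/
def J {p : M} (v : T p) : T p := (Complex.I • toTc v : Tc p)

/-- Smooth (that is, real `C^∞`) maps `M → ℝⁿ`. -/
def Smooth (f : M → E n) : Prop := ContMDiff 𝓘(ℝ, ℂ) 𝓘(ℝ, E n) ∞ f

/-- The differential of an `ℝⁿ`-valued map at `p`, an `ℝⁿ`-valued linear form on `T p`. -/
def d (f : M → E n) (p : M) : T p →L[ℝ] E n := mfderiv 𝓘(ℝ, ℂ) 𝓘(ℝ, E n) f p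

/-- The differential of an `ℝⁿ`-valued map at `p`, seen as a `Cl n`-valued form. -/
def dCl (f : M → E n) (p : M) : T p →ₗ[ℝ] Cl n := inc ∘ₗ (d f p).toLinearMap

/-- The form `a α b`, for `a, b` in the Clifford algebra and a form `α` with values in it. -/
def sandwich {p : M} (a : Cl n) (α : T p →ₗ[ℝ] Cl n) (b : Cl n) : T p →ₗ[ℝ] Cl n :=
  LinearMap.mulLeft ℝ a ∘ₗ LinearMap.mulRight ℝ b ∘ₗ α

/-- The exterior product of two `Cl n`-valued `1`-forms:
`(α ∧ β)(v, w) = α(v) β(w) - α(w) β(v)`, where the products are those of the Clifford algebra. -/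
def wedge {p : M} (α β : T p →ₗ[ℝ] Cl n) (v w : T p) : Cl n := α v * β w - α w * β v

/-- The `(2,0)`-part `(α, β)^{2,0}` of the bilinear form `(α(v), β(w))`: its complex bilinear
extension evaluated at `v^{1,0} = (v - i J v) / 2` and `w^{1,0} = (w - i J w) / 2`.
In a holomorphic coordinate `z` it is `(α(∂/∂z), β(∂/∂z)) dz²`. -/
def twoZero {p : M} (α β : T p →L[ℝ] E n) (v w : T p) : ℂ :=
  (1 / 4 : ℂ) *
    (((inner ℝ (α v) (β w) - inner ℝ (α (J v)) (β (J w)) : ℝ) : ℂ)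
      - Complex.I * ((inner ℝ (α v) (β (J w)) + inner ℝ (α (J v)) (β w) : ℝ) : ℂ))

end Forms

/-! ### Polarised Riemann surfaces and isothermic surfaces -/

/-- A holomorphic quadratic differential on `M`: a field of complex bilinear forms on the
tangent lines whose coefficient `q` in each chart `z`, where it reads `q dz²`, is holomorphic. -/
structure HolQuadDiff (M : Type*) [TopologicalSpace M] [ChartedSpace ℂ M] where
  /-- The bilinear form at each point. -/
  form : ∀ p : M, Tc p →ₗ[ℂ] Tc p →ₗ[ℂ] ℂ
  holomorphic : ∀ φ ∈ atlas ℂ M,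
    DifferentiableOn ℂ
      (fun z : ℂ => form (φ.symm z)
        (mfderiv 𝓘(ℂ, ℂ) 𝓘(ℂ, ℂ) φ.symm z (1 : ℂ))
        (mfderiv 𝓘(ℂ, ℂ) 𝓘(ℂ, ℂ) φ.symm z (1 : ℂ)))
      φ.target

section Surfaces

variable {M : Type*} [TopologicalSpace M] [ChartedSpace ℂ M] {n : ℕ}

/-- `f` is a conformal immersion at each point of `U`: its differential is injective there and
`(df, df)^{2,0} = 0`. -/
def IsConformalImmersionOn (f : M → E n) (U : Set M) : Prop :=
  ∀ p ∈ U, Function.Injective (d f p) ∧ ∀ v w : T p, twoZero (d f p) (d f p) v w = 0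

/-- `fc` is a Christoffel transform of `f` with respect to `Q`:
`df ∧ dfc = 0` and `(df, dfc)^{2,0} = Q`. -/
structure IsChristoffelTransform (Q : HolQuadDiff M) (f fc : M → E n) : Prop where
  smooth : Smooth fc
  wedge_eq_zero : ∀ (p : M) (v w : T p), wedge (dCl f p) (dCl fc p) v w = 0
  twoZero_eq : ∀ (p : M) (v w : T p), twoZero (d f p) (d fc p) v w = Q.form p (toTc v) (toTc w)

/-- `f : (M, Q) → ℝⁿ` is isothermic with Christoffel transform `fc`. -/
structure IsIsothermic (Q : HolQuadDiff M) (f fc : M → E n) : Prop where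
  smooth : Smooth f
  conformal : IsConformalImmersionOn f Set.univ
  christoffel : IsChristoffelTransform Q f fc

/-- `f` and `fh` form a Darboux pair: both are smooth and non-constant, `g = fh - f` is nowhere
zero, and `df ∧ g⁻¹ dfh g⁻¹ = 0`. -/
structure IsDarbouxPair (f fh : M → E n) : Prop where
  smooth_left : Smooth f
  smooth_right : Smooth fh
  nonconst_left : ∃ p q : M, f p ≠ f q
  nonconst_right : ∃ p q : M, fh p ≠ fh q
  ne : ∀ p : M, fh p - f p ≠ 0
  wedge_eq_zero : ∀ (p : M) (v w : T p),
    wedge (dCl f p)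
      (sandwich (inc (vinv (fh p - f p))) (dCl fh p) (inc (vinv (fh p - f p)))) v w = 0

/-- `f + g = 𝓓_r f`, where `fc` is the Christoffel transform of `f`: the smooth map `g` is nowhere
zero and solves the Riccati equation `dg = r g dfc g - df`. -/
structure IsDarbouxTransform (r : ℝ) (f fc g : M → E n) : Prop where
  smooth : Smooth g
  ne : ∀ p : M, g p ≠ 0
  riccati : ∀ p : M, dCl g p = r • sandwich (inc (g p)) (dCl fc p) (inc (g p)) - dCl f p

end Surfaces

end Isothermic

end

open Isothermic

noncomputable section

namespace Isothermic

/-! ### Clifford multiplication of vectors -/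

section Clifford

variable {n : ℕ}

/-! The Riccati equation says exactly `d(f + g) = r g dfc g`. Since `d(v⁻¹) = -v⁻¹ dv v⁻¹`, it is
equivalent to the Riccati equation for `(r g)⁻¹` with `f` and `fc` exchanged (`d_vinv_apply`), so
`d(fc + (r g)⁻¹) = r⁻¹ g⁻¹ df g⁻¹`. In the product of these two differentials the inner factors `g
g⁻¹` cancel, so their wedge is `g (dfc ∧ df) g⁻¹ = 0`. The maps `x ↦ g x g` and `y ↦ g⁻¹ y g⁻¹`
together preserve the inner product, so the `(2,0)`-part is still `Q`.

Conformality and uniqueness rest on a normal form (`exists_eq_of_wedge_eq_zero`): if `α` is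
injective and conformal, with values `a`, `b` on `1`, `i`, and `α ∧ β = 0`, then `β` takes the
values `s a + t b`, `t a - s b`, and `(α, β)^{2,0}` has coefficient `‖a‖² (s - i t) / 2`. So `β` is
conformal unless it vanishes, and its `(2,0)`-part determines it. Off the zeros of `Q` this makes
`fc` conformal, hence also `f + g`, and two Christoffel transforms of `f + g` have equal
differentials there. That set is dense by the identity theorem, so they differ by a constant. -/

theorem algebraMap_Cl_injective : Function.Injective (algebraMap ℝ (Cl n)) :=
  (algebraMap ℝ (Cl n)).injective

theorem inc_mul_self (x : E n) : inc x * inc x = algebraMap ℝ (Cl n) (-‖x‖ ^ 2) := by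
  rw [CliffordAlgebra.ι_sq_scalar, negQ_apply]

theorem inc_mul_add_swap (x y : E n) :
    inc x * inc y + inc y * inc x = algebraMap ℝ (Cl n) (-(2 * inner ℝ x y)) := by
  rw [CliffordAlgebra.ι_mul_ι_add_swap, QuadraticMap.polar, negQ_apply, negQ_apply, negQ_apply,
    norm_add_sq_real]
  congr 1
  ring

theorem inc_mul_swap (x y : E n) :
    inc x * inc y = (-(2 * inner ℝ x y) : ℝ) • (1 : Cl n) - inc y * inc x := by
  rw [← Algebra.algebraMap_eq_smul_one, ← inc_mul_add_swap, add_sub_cancel_right]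

theorem inc_mul_self' (x : E n) : inc x * inc x = (-‖x‖ ^ 2 : ℝ) • (1 : Cl n) := by
  rw [inc_mul_self, Algebra.algebraMap_eq_smul_one]

theorem inc_injective : Function.Injective (inc : E n →ₗ[ℝ] Cl n) := by
  rw [injective_iff_map_eq_zero]
  intro x hx
  have h := inc_mul_self x
  rw [hx, zero_mul, ← map_zero (algebraMap ℝ (Cl n))] at h
  simpa using algebraMap_Cl_injective h

/-- The map `x ↦ a x a` (products in the Clifford algebra) of `ℝⁿ`. -/
def conj (a : E n) : E n →L[ℝ] E n :=
  ‖a‖ ^ 2 • ContinuousLinearMap.id ℝ (E n) - ((2 : ℝ) • innerSL ℝ a).smulRight a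

theorem conj_apply (a x : E n) : conj a x = ‖a‖ ^ 2 • x - (2 * inner ℝ a x) • a := by
  simp [conj]

theorem inc_conj (a x : E n) : inc (conj a x) = inc a * inc x * inc a := by
  rw [inc_mul_swap, sub_mul, mul_assoc, inc_mul_self', conj_apply, map_sub, map_smul, map_smul]
  simp only [smul_mul_assoc, mul_smul_comm, one_mul, mul_one]
  module

/-- For `a ≠ 0`, `conj a` is `‖a‖ ^ 2` times the reflection in the hyperplane orthogonal to `a`. -/
theorem inner_conj_conj (a x y : E n) :
    inner ℝ (conj a x) (conj a y) = ‖a‖ ^ 4 * inner ℝ x y := by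
  simp only [conj_apply, inner_sub_left, inner_sub_right, real_inner_smul_left,
    real_inner_smul_right, real_inner_self_eq_norm_sq, real_inner_comm a]
  ring

theorem conj_smul_left (c : ℝ) (a x : E n) : conj (c • a) x = c ^ 2 • conj a x := by
  simp only [conj_apply, norm_smul, mul_pow, Real.norm_eq_abs, sq_abs, real_inner_smul_left]
  module

theorem conj_vinv {a : E n} (ha : a ≠ 0) (x : E n) :
    conj (vinv a) x = (‖a‖ ^ 4)⁻¹ • conj a x := by
  rw [vinv, ← neg_smul, conj_smul_left]
  congr 1
  field_simp

theorem conj_vinv_conj {a : E n} (ha : a ≠ 0) (x : E n) : conj (vinv a) (conj a x) = x := by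
  apply inc_injective
  rw [inc_conj, inc_conj, ← mul_assoc, ← mul_assoc, inc_vinv_mul_inc ha, one_mul, mul_assoc,
    inc_mul_inc_vinv ha, mul_one]

theorem vinv_ne_zero {a : E n} (ha : a ≠ 0) : vinv a ≠ 0 := by
  simpa [vinv] using ha

theorem vinv_smul {c : ℝ} (hc : c ≠ 0) (a : E n) : vinv (c • a) = c⁻¹ • vinv a := by
  simp only [vinv, norm_smul, mul_pow, Real.norm_eq_abs, sq_abs, smul_neg, smul_smul, mul_inv]
  congr 2
  field_simp

theorem contDiffAt_vinv {a : E n} (ha : a ≠ 0) : ContDiffAt ℝ ∞ (vinv : E n → E n) a := by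
  unfold vinv
  have h : ‖a‖ ^ 2 ≠ 0 := by simpa using ha
  exact (((contDiff_norm_sq ℝ).contDiffAt.inv h).smul contDiffAt_id).neg

theorem hasFDerivAt_vinv {a : E n} (ha : a ≠ 0) :
    HasFDerivAt (vinv : E n → E n) (-conj (vinv a)) a := by
  have h : ‖a‖ ^ 2 ≠ 0 := by simpa using ha
  have h1 : HasFDerivAt (fun x : E n => ‖x‖ ^ 2) (2 • innerSL ℝ a) a :=
    (hasStrictFDerivAt_norm_sq a).hasFDerivAt
  have h2 := (((hasDerivAt_inv h).comp_hasFDerivAt a h1).smul (hasFDerivAt_id a)).neg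
  refine h2.congr_fderiv ?_
  ext1 x
  rw [neg_apply, neg_apply, conj_vinv ha, conj_apply]
  simp [smul_sub, smul_smul]
  have e : (‖a‖ ^ 4)⁻¹ * ‖a‖ ^ 2 = (‖a‖ ^ 2)⁻¹ := by field_simp
  have e' : ((‖a‖ ^ 2) ^ 2)⁻¹ = (‖a‖ ^ 4)⁻¹ := by ring_nf
  rw [e, e']
  module

/-- Vectors `x, y` with `a y = b x`, for orthogonal `a, b` of the same non-zero length, lie in the
plane of `a` and `b`. -/
theorem exists_eq_of_inc_mul_eq {a b x y : E n} (hab : inner ℝ a b = 0) (hn : ‖a‖ = ‖b‖)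
    (ha : a ≠ 0) (h : inc a * inc y = inc b * inc x) :
    ∃ s t : ℝ, x = s • a + t • b ∧ y = t • a - s • b := by
  have hl : ‖a‖ ≠ 0 := by simpa using ha
  -- `s a + t b` is the projection of `x` to the plane, and `t a - s b` is its partner under `a y =
  -- b x`; the remainders `w`, `u` satisfy the same relation and must vanish.
  set s := inner ℝ a x / ‖a‖ ^ 2 with hs
  set t := inner ℝ b x / ‖a‖ ^ 2 with ht
  set w := x - (s • a + t • b) with hw
  set u := y - (t • a - s • b) with hu
  have haw : inner ℝ a w = 0 := by
    simp only [hw, hs, inner_sub_right, inner_add_right, real_inner_smul_right, hab,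
      real_inner_self_eq_norm_sq]
    field_simp
    ring
  have hbw : inner ℝ b w = 0 := by
    simp only [hw, ht, inner_sub_right, inner_add_right, real_inner_smul_right,
      real_inner_comm a b, hab, real_inner_self_eq_norm_sq, ← hn]
    field_simp
    ring
  have anti : ∀ {c e : E n}, inner ℝ c e = 0 → inc c * inc e = -(inc e * inc c) := by
    intro c e hce
    rw [inc_mul_swap, hce]
    simp
  have haa := inc_mul_self' a
  have hbb := inc_mul_self' b
  rw [← hn] at hbb
  have key : inc a * inc u = inc b * inc w := by
    simp only [hu, hw, map_sub, map_add, map_smul, mul_sub, mul_add, mul_smul_comm, h, haa, hbb,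
      anti hab]
    module
  have hu' : (-‖a‖ ^ 2) • inc u = inc a * inc b * inc w := by
    rw [mul_assoc, ← key, ← mul_assoc, haa, smul_mul_assoc, one_mul]
  -- `w` commutes with `a b`, and `(a b)² = -‖a‖⁴`. Squaring `-‖a‖² u = a b w` thus gives `-‖a‖⁴
  -- ‖u‖² = ‖a‖⁴ ‖w‖²`; the opposite signs force `u = w = 0`.
  have hsq : inc a * inc b * inc w * (inc a * inc b * inc w)
      = (‖a‖ ^ 4 * ‖w‖ ^ 2) • (1 : Cl n) := by
    have hw' : inc w * (inc a * inc b) = inc a * inc b * inc w := by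
      rw [← mul_assoc, anti ((real_inner_comm _ _).trans haw), neg_mul, mul_assoc,
        anti ((real_inner_comm _ _).trans hbw), mul_neg, neg_neg, mul_assoc]
    have hab' : inc a * inc b * (inc a * inc b) = (-‖a‖ ^ 4 : ℝ) • (1 : Cl n) := by
      rw [mul_assoc, ← mul_assoc (inc b), anti ((real_inner_comm _ _).trans hab), neg_mul,
        mul_assoc, hbb, mul_neg, ← mul_assoc, haa, smul_mul_smul_comm, one_mul, ← neg_smul]
      congr 1; ring
    rw [mul_assoc, ← mul_assoc (inc w), hw', mul_assoc (inc a * inc b), inc_mul_self',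
      mul_smul_comm, mul_one, mul_smul_comm, hab', smul_smul]
    congr 1; ring
  rw [← hu', smul_mul_assoc, mul_smul_comm, inc_mul_self', smul_smul, smul_smul,
    ← Algebra.algebraMap_eq_smul_one, ← Algebra.algebraMap_eq_smul_one] at hsq
  have hz : ‖a‖ ^ 4 * (‖u‖ ^ 2 + ‖w‖ ^ 2) = 0 := by
    linear_combination -algebraMap_Cl_injective hsq
  have hz' : ‖u‖ ^ 2 + ‖w‖ ^ 2 = 0 := (mul_eq_zero.mp hz).resolve_left (pow_ne_zero 4 hl)
  have hu0 : u = 0 := by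
    have : ‖u‖ ^ 2 = 0 := by linarith [sq_nonneg ‖u‖, sq_nonneg ‖w‖]
    simpa using this
  have hw0 : w = 0 := by
    have : ‖w‖ ^ 2 = 0 := by linarith [sq_nonneg ‖u‖, sq_nonneg ‖w‖]
    simpa using this
  exact ⟨s, t, sub_eq_zero.mp hw0, sub_eq_zero.mp hu0⟩

end Clifford

/-! ### Maps and quadratic differentials on a Riemann surface -/

section RiemannSurface

open Topology Filter

variable {M : Type*} [TopologicalSpace M] [ChartedSpace ℂ M]

theorem isManifold_real [IsManifold 𝓘(ℂ, ℂ) ω M] : IsManifold 𝓘(ℝ, ℂ) ∞ M := by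
  refine isManifold_of_contDiffOn _ _ _ fun e e' he he' => ?_
  have h := (contDiffGroupoid ω 𝓘(ℂ, ℂ)).compatible he he'
  rw [contDiffGroupoid, mem_groupoid_of_pregroupoid] at h
  exact (h.1.restrict_scalars ℝ).of_le le_top

/-- The tangent line is one-dimensional over `ℂ`; symmetry of `Q` and the test for its zeros on a
single vector both follow. -/
theorem HolQuadDiff.form_apply (Q : HolQuadDiff M) (p : M) (v w : ℂ) :
    Q.form p v w = v * w * Q.form p (1 : ℂ) (1 : ℂ) := by
  have key : ∀ B : ℂ →ₗ[ℂ] ℂ →ₗ[ℂ] ℂ, B v w = v * w * B 1 1 := by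
    intro B
    conv_lhs => rw [← mul_one v, ← mul_one w, ← smul_eq_mul, ← smul_eq_mul]
    rw [map_smul, map_smul, LinearMap.smul_apply, smul_eq_mul, smul_eq_mul]
    ring
  exact key (Q.form p)

theorem HolQuadDiff.form_eq_zero_iff (Q : HolQuadDiff M) {p : M} {v : ℂ} (hv : v ≠ 0) :
    Q.form p = 0 ↔ Q.form p v v = 0 := by
  refine ⟨fun h => by rw [h]; rfl, fun h => ?_⟩
  rw [Q.form_apply] at h
  refine LinearMap.ext fun x => LinearMap.ext fun y => (Q.form_apply p x y).trans ?_
  rw [(mul_eq_zero.mp h).resolve_left (mul_ne_zero hv hv), mul_zero]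
  rfl

theorem HolQuadDiff.symm (Q : HolQuadDiff M) (p : M) (v w : Tc p) :
    Q.form p v w = Q.form p w v := by
  refine (Q.form_apply p v w).trans (.trans ?_ (Q.form_apply p w v).symm)
  exact congrArg (· * _) (mul_comm (G := ℂ) v w)

/-- The zeros of a holomorphic quadratic differential that is not identically zero have a dense
complement. -/
theorem HolQuadDiff.dense_ne_zero [IsManifold 𝓘(ℂ, ℂ) ω M] [ConnectedSpace M]
    (Q : HolQuadDiff M) (hQ : ∃ p : M, Q.form p ≠ 0) : Dense {p | Q.form p ≠ 0} := by
  have : IsManifold 𝓘(ℂ, ℂ) 1 M := IsManifold.of_le le_top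
  set A := interior {p | Q.form p = 0} with hA
  -- A chart disc around a closure point of `A` meets the open set `A`, so the coefficient of `Q`
  -- vanishes on the whole disc by the identity theorem.
  have hclosed : IsClosed A := by
    refine isClosed_of_closure_subset fun p hp => ?_
    set φ := chartAt ℂ p
    have hφ := chart_mem_atlas ℂ p
    have hmd := mdifferentiable_of_mem_atlas (I := 𝓘(ℂ, ℂ)) hφ
    set q : ℂ → ℂ := fun z : ℂ => Q.form (φ.symm z)
        (mfderiv 𝓘(ℂ, ℂ) 𝓘(ℂ, ℂ) φ.symm z (1 : ℂ))
        (mfderiv 𝓘(ℂ, ℂ) 𝓘(ℂ, ℂ) φ.symm z (1 : ℂ)) with hq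
    have hq0 : ∀ z ∈ φ.target, (Q.form (φ.symm z) = 0 ↔ q z = 0) := by
      intro z hz
      apply Q.form_eq_zero_iff
      intro h0
      exact one_ne_zero (α := ℂ) ((hmd.symm.mfderiv_injective hz) (h0.trans (map_zero _).symm))
    obtain ⟨ε, hε, hB⟩ := Metric.isOpen_iff.mp φ.open_target (φ p) (mem_chart_target ℂ p)
    have han : AnalyticOnNhd ℂ q (Metric.ball (φ p) ε) :=
      ((Q.holomorphic φ hφ).mono hB).analyticOnNhd Metric.isOpen_ball
    have hN : φ.source ∩ φ ⁻¹' Metric.ball (φ p) ε ∈ 𝓝 p :=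
      (φ.isOpen_inter_preimage Metric.isOpen_ball).mem_nhds
        ⟨mem_chart_source ℂ p, Metric.mem_ball_self hε⟩
    obtain ⟨x, ⟨hx1, hx2⟩, hxA⟩ := mem_closure_iff_nhds.mp hp _ hN
    have hev : q =ᶠ[𝓝 (φ x)] 0 := by
      have ht := φ.map_source hx1
      have hc : ContinuousAt φ.symm (φ x) := φ.continuousAt_symm ht
      have hA' : A ∈ 𝓝 (φ.symm (φ x)) := by
        rw [φ.left_inv hx1]; exact isOpen_interior.mem_nhds hxA
      filter_upwards [hc.preimage_mem_nhds hA', φ.open_target.mem_nhds ht] with z hz hz'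
      exact (hq0 z hz').mp (interior_subset hz : φ.symm z ∈ {p | Q.form p = 0})
    have hzero := han.eqOn_zero_of_preconnected_of_eventuallyEq_zero
      (convex_ball (φ p) ε).isPreconnected hx2 hev
    rw [hA, mem_interior_iff_mem_nhds]
    filter_upwards [hN] with y hy
    have := (hq0 (φ y) (φ.map_source hy.1)).mpr (hzero hy.2)
    rwa [φ.left_inv hy.1] at this
  rcases isClopen_iff.mp ⟨hclosed, isOpen_interior⟩ with h | h
  · rw [interior_eq_empty_iff_dense_compl] at h
    exact h
  · obtain ⟨p, hp⟩ := hQ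
    exact absurd (interior_subset (h ▸ Set.mem_univ p : p ∈ A)) hp

variable {n : ℕ}

theorem Smooth.hasMFDerivAt {f : M → E n} (hf : Smooth f) (p : M) :
    HasMFDerivAt 𝓘(ℝ, ℂ) 𝓘(ℝ, E n) f p (d f p) :=
  (hf.mdifferentiable (by simp) p).hasMFDerivAt

theorem d_add {f g : M → E n} (hf : Smooth f) (hg : Smooth g) (p : M) :
    d (fun p => f p + g p) p = d f p + d g p :=
  ((hf.hasMFDerivAt p).add (hg.hasMFDerivAt p)).mfderiv

theorem d_sub {f g : M → E n} (hf : Smooth f) (hg : Smooth g) (p : M) :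
    d (fun p => f p - g p) p = d f p - d g p :=
  ((hf.hasMFDerivAt p).sub (hg.hasMFDerivAt p)).mfderiv

theorem d_const (k : E n) (p : M) : d (fun _ : M => k) p = 0 := mfderiv_const

theorem smooth_const (k : E n) : Smooth (fun _ : M => k) := contMDiff_const

theorem Smooth.add {f g : M → E n} (hf : Smooth f) (hg : Smooth g) :
    Smooth (fun p => f p + g p) := ContMDiff.add hf hg

theorem Smooth.sub {f g : M → E n} (hf : Smooth f) (hg : Smooth g) :
    Smooth (fun p => f p - g p) := ContMDiff.sub hf hg

theorem Smooth.const_smul {f : M → E n} (hf : Smooth f) (c : ℝ) :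
    Smooth (fun p => c • f p) :=
  (contDiff_const_smul (𝕜 := ℝ) (F := E n) c).contMDiff.comp hf

theorem Smooth.vinv {f : M → E n} (hf : Smooth f) (h0 : ∀ p, f p ≠ 0) :
    Smooth (fun p => vinv (f p)) := fun p =>
  (contDiffAt_vinv (h0 p)).contMDiffAt.comp p (hf p)

theorem d_const_smul {f : M → E n} (hf : Smooth f) (c : ℝ) (p : M) :
    d (fun p => c • f p) p = c • d f p :=
  ((hf.hasMFDerivAt p).const_smul c).mfderiv

theorem d_vinv {f : M → E n} (hf : Smooth f) {p : M} (h0 : f p ≠ 0) (v : T p) :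
    d (fun p => Isothermic.vinv (f p)) p v = -conj (Isothermic.vinv (f p)) (d f p v) := by
  have h := ((hasFDerivAt_vinv h0).hasMFDerivAt.comp p (hf.hasMFDerivAt p)).mfderiv
  exact DFunLike.congr_fun h v

/-- A smooth map on a connected surface whose differential vanishes on a dense set is constant. -/
theorem Smooth.exists_eq_const [IsManifold 𝓘(ℂ, ℂ) ω M] [ConnectedSpace M] {f : M → E n}
    (hf : Smooth f) {S : Set M} (hS : Dense S) (h : ∀ p ∈ S, d f p = 0) :
    ∃ k, ∀ p, f p = k := by
  have : IsManifold 𝓘(ℝ, ℂ) ∞ M := isManifold_real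
  have : IsManifold 𝓘(ℝ, ℂ) 1 M := IsManifold.of_le (n := ∞) (by simp)
  have hloc : IsLocallyConstant f := by
    rw [IsLocallyConstant.iff_eventually_eq]
    intro p
    set φ := chartAt ℂ p
    have hφ := chart_mem_atlas ℂ p
    have hmd := mdifferentiable_of_mem_atlas (I := 𝓘(ℝ, ℂ)) hφ
    have hu : ContDiffOn ℝ ∞ (f ∘ φ.symm) φ.target :=
      (hf.comp_contMDiffOn (contMDiffOn_chart_symm (x := p))).contDiffOn
    have hcont : ContinuousOn (fderiv ℝ (f ∘ φ.symm)) φ.target :=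
      hu.continuousOn_fderiv_of_isOpen φ.open_target (by simp)
    -- The set where the derivative is non-zero is open, so if non-empty it would meet the dense set
    -- `S`.
    have hzero : φ.target.EqOn (fderiv ℝ (f ∘ φ.symm)) 0 := by
      intro z hz
      by_contra hne
      have hopen := hcont.isOpen_inter_preimage φ.open_target
        (isOpen_compl_singleton (x := (0 : ℂ →L[ℝ] E n)))
      obtain ⟨y, ⟨hy1, hy2⟩, hyS⟩ := hS.inter_open_nonempty _ (φ.isOpen_inter_preimage hopen)
        ⟨φ.symm z, φ.map_target hz, by
          rw [Set.mem_preimage, φ.right_inv hz]; exact ⟨hz, hne⟩⟩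
      refine hy2.2 ?_
      have hc := (hf.hasMFDerivAt (φ.symm (φ y))).comp (φ y)
        (hmd.mdifferentiableAt_symm hy2.1).hasMFDerivAt
      have hd0 : d f (φ.symm (φ y)) = 0 := h _ (by rwa [φ.left_inv hy1])
      rw [hd0] at hc
      rw [Set.mem_singleton_iff, ← mfderiv_eq_fderiv]
      exact hc.mfderiv.trans (ContinuousLinearMap.ext fun _ => rfl)
    obtain ⟨ε, hε, hB⟩ := Metric.isOpen_iff.mp φ.open_target (φ p) (mem_chart_target ℂ p)
    have hN : φ.source ∩ φ ⁻¹' Metric.ball (φ p) ε ∈ 𝓝 p :=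
      (φ.isOpen_inter_preimage Metric.isOpen_ball).mem_nhds
        ⟨mem_chart_source ℂ p, Metric.mem_ball_self hε⟩
    filter_upwards [hN] with y hy
    have := Metric.isOpen_ball.is_const_of_fderiv_eq_zero (convex_ball (φ p) ε).isPreconnected
      ((hu.differentiableOn (by simp)).mono hB) (hzero.mono hB) hy.2 (Metric.mem_ball_self hε)
    simpa [φ.left_inv hy.1, φ.left_inv (mem_chart_source ℂ p)] using this
  obtain ⟨k, hk⟩ := hloc.exists_eq_const
  exact ⟨k, fun p => congrFun hk p⟩

end RiemannSurface

/-! ### Pointwise relations between the differentials -/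

section Pointwise

variable {M : Type*} [TopologicalSpace M] [ChartedSpace ℂ M] {n : ℕ} {p : M}

/-- These are the imaginary and real parts of the equation at `(v, v)`. -/
theorem inner_eq_of_twoZero_self_eq_zero {α : T p →L[ℝ] E n}
    (h : ∀ v w : T p, twoZero α α v w = 0) (v : T p) :
    inner ℝ (α v) (α (J v)) = 0 ∧ ‖α v‖ = ‖α (J v)‖ := by
  have h1 := h v v
  rw [twoZero, real_inner_self_eq_norm_sq, real_inner_self_eq_norm_sq,
    real_inner_comm (α v)] at h1
  have h2 := congrArg Complex.re h1
  have h3 := congrArg Complex.im h1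
  simp [-Complex.ofReal_sub, -Complex.ofReal_pow, -Complex.ofReal_add] at h2 h3
  refine ⟨by linarith, ?_⟩
  exact (sq_eq_sq₀ (norm_nonneg _) (norm_nonneg _)).mp (by linarith)

theorem twoZero_comm (α β : T p →L[ℝ] E n) (v w : T p) :
    twoZero α β v w = twoZero β α w v := by
  simp only [twoZero]
  simp only [real_inner_comm (α _)]
  push_cast
  ring

theorem twoZero_sub_right (α β γ : T p →L[ℝ] E n) (v w : T p) :
    twoZero α (β - γ) v w = twoZero α β v w - twoZero α γ v w := by
  simp only [twoZero, sub_apply, inner_sub_right]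
  push_cast
  ring

theorem J_J (v : T p) : J (J v) = -v := by
  change Complex.I * (Complex.I * (show ℂ from v)) = -(show ℂ from v)
  rw [← mul_assoc, Complex.I_mul_I, neg_one_mul]

/-- Every tangent vector is a real combination of `v` and `J v`, for `v ≠ 0`. -/
theorem exists_eq_smul_add_smul_J {v : T p} (hv : v ≠ 0) (w : T p) :
    ∃ s t : ℝ, w = s • v + t • J v := by
  have key : ∀ v w : ℂ, v ≠ 0 → ∃ s t : ℝ, w = s • v + t • (Complex.I * v) := fun v w hv => by
    refine ⟨(w / v).re, (w / v).im, ?_⟩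
    rw [Complex.real_smul, Complex.real_smul, ← mul_assoc, ← add_mul, Complex.re_add_im,
      div_mul_cancel₀ _ hv]
  exact key v w hv

/-- The basic tangent vector at `p`. -/
def oneT (p : M) : T p := (1 : ℂ)

theorem oneT_ne_zero : oneT p ≠ 0 := one_ne_zero (α := ℂ)

theorem clm_eq_zero {α : T p →L[ℝ] E n} (h0 : α (oneT p) = 0) (h1 : α (J (oneT p)) = 0) :
    α = 0 := by
  ext1 w
  obtain ⟨s, t, rfl⟩ := exists_eq_smul_add_smul_J oneT_ne_zero w
  simp [h0, h1]

/-- Structure of a form `β` with `α ∧ β = 0`, for `α` conformal. -/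
theorem exists_eq_of_wedge_eq_zero {α β : T p →L[ℝ] E n} (hi : Function.Injective α)
    (hc : ∀ v w : T p, twoZero α α v w = 0)
    (hw : ∀ v w : T p, inc (α v) * inc (β w) = inc (α w) * inc (β v)) :
    ∃ s t : ℝ, β (oneT p) = s • α (oneT p) + t • α (J (oneT p)) ∧
      β (J (oneT p)) = t • α (oneT p) - s • α (J (oneT p)) ∧
      twoZero α β (oneT p) (oneT p) = (1 / 2 * ‖α (oneT p)‖ ^ 2 : ℝ) * (s - Complex.I * t) := by
  obtain ⟨h1, h2⟩ := inner_eq_of_twoZero_self_eq_zero hc (oneT p)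
  have h0 : α (oneT p) ≠ 0 := fun h => oneT_ne_zero (hi (h.trans (map_zero α).symm))
  obtain ⟨s, t, hx, hy⟩ := exists_eq_of_inc_mul_eq h1 h2 h0 (hw (oneT p) (J (oneT p)))
  refine ⟨s, t, hx, hy, ?_⟩
  rw [twoZero, hx, hy]
  simp only [inner_add_right, inner_sub_right, real_inner_smul_right, real_inner_self_eq_norm_sq,
    h1, (real_inner_comm _ _).trans h1, ← h2]
  push_cast
  ring

/-- A form `β` with `α ∧ β = 0` and `(α, β)^{2,0} = 0` vanishes, for `α` conformal. -/
theorem eq_zero_of_wedge_eq_zero {α β : T p →L[ℝ] E n} (hi : Function.Injective α)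
    (hc : ∀ v w : T p, twoZero α α v w = 0)
    (hw : ∀ v w : T p, inc (α v) * inc (β w) = inc (α w) * inc (β v))
    (h0 : twoZero α β (oneT p) (oneT p) = 0) : β = 0 := by
  obtain ⟨s, t, hx, hy, h⟩ := exists_eq_of_wedge_eq_zero hi hc hw
  have ha : ‖α (oneT p)‖ ≠ 0 :=
    norm_ne_zero_iff.mpr fun h => oneT_ne_zero (hi (h.trans (map_zero α).symm))
  rw [h0, eq_comm, mul_eq_zero, Complex.ofReal_eq_zero] at h
  have h' := h.resolve_left (by positivity)
  have hs := congrArg Complex.re h'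
  have ht := congrArg Complex.im h'
  simp at hs ht
  exact clm_eq_zero (by simp [hx, hs, ht]) (by simp [hy, hs, ht])

/-- A form `β ≠ 0` with `α ∧ β = 0` is conformal and injective, for `α` conformal. -/
theorem conformal_of_wedge_eq_zero {α β : T p →L[ℝ] E n} (hi : Function.Injective α)
    (hc : ∀ v w : T p, twoZero α α v w = 0)
    (hw : ∀ v w : T p, inc (α v) * inc (β w) = inc (α w) * inc (β v))
    (h0 : β ≠ 0) : Function.Injective β ∧ ∀ v w : T p, twoZero β β v w = 0 := by
  obtain ⟨s, t, hx, hy, -⟩ := exists_eq_of_wedge_eq_zero hi hc hw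
  obtain ⟨h1, h2⟩ := inner_eq_of_twoZero_self_eq_zero hc (oneT p)
  have h1' := (real_inner_comm _ _).trans h1
  have ha : ‖α (oneT p)‖ ≠ 0 :=
    norm_ne_zero_iff.mpr fun h => oneT_ne_zero (hi (h.trans (map_zero α).symm))
  -- The normal form makes the two values of `β` orthogonal, of common squared length `(s² + t²)
  -- ‖a‖²` with `a = α (oneT p)`.
  have hxy : inner ℝ (β (oneT p)) (β (J (oneT p))) = 0 := by
    rw [hx, hy]
    simp only [inner_add_left, inner_sub_right, real_inner_smul_left,
      real_inner_smul_right, real_inner_self_eq_norm_sq, h1, h1', ← h2]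
    ring
  have hyx := (real_inner_comm _ _).trans hxy
  have hx2 : ‖β (oneT p)‖ ^ 2 = (s ^ 2 + t ^ 2) * ‖α (oneT p)‖ ^ 2 := by
    rw [← real_inner_self_eq_norm_sq, hx]
    simp only [inner_add_left, inner_add_right, real_inner_smul_left, norm_smul, mul_pow,
      Real.norm_eq_abs, sq_abs, real_inner_smul_right, real_inner_self_eq_norm_sq, h1, h1', ← h2]
    ring
  have hy2 : ‖β (J (oneT p))‖ ^ 2 = (s ^ 2 + t ^ 2) * ‖α (oneT p)‖ ^ 2 := by
    rw [← real_inner_self_eq_norm_sq, hy]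
    simp only [inner_sub_left, inner_sub_right, real_inner_smul_left, norm_smul, mul_pow,
      Real.norm_eq_abs, sq_abs, real_inner_smul_right, real_inner_self_eq_norm_sq, h1, h1', ← h2]
    ring
  have hpos : (s ^ 2 + t ^ 2) * ‖α (oneT p)‖ ^ 2 ≠ 0 := by
    intro hz
    rw [hz] at hx2 hy2
    exact h0 (clm_eq_zero (by simpa using hx2) (by simpa using hy2))
  constructor
  · rw [injective_iff_map_eq_zero]
    intro v hv
    obtain ⟨k, l, rfl⟩ := exists_eq_smul_add_smul_J oneT_ne_zero v
    rw [map_add, map_smul, map_smul] at hv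
    have e := congrArg (fun z => inner ℝ z z) hv
    simp only [inner_add_left, inner_add_right, real_inner_smul_left, inner_zero_left,
      real_inner_smul_right, real_inner_self_eq_norm_sq, hxy, hyx, hx2, hy2,
      norm_smul, mul_pow, Real.norm_eq_abs, sq_abs] at e
    have e' : ((s ^ 2 + t ^ 2) * ‖α (oneT p)‖ ^ 2) * (k ^ 2 + l ^ 2) = 0 := by
      linear_combination e
    have e2 := (mul_eq_zero.mp e').resolve_left hpos
    have hk : k = 0 := by nlinarith [sq_nonneg k, sq_nonneg l]
    have hl : l = 0 := by nlinarith [sq_nonneg k, sq_nonneg l]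
    simp [hk, hl]
  · intro v w
    obtain ⟨k, l, rfl⟩ := exists_eq_smul_add_smul_J oneT_ne_zero v
    obtain ⟨k', l', rfl⟩ := exists_eq_smul_add_smul_J oneT_ne_zero w
    have hJ : ∀ k l : ℝ, J (k • oneT p + l • J (oneT p)) = (-l) • oneT p + k • J (oneT p) := by
      intro k l
      have hl : J (l • J (oneT p)) = l • J (J (oneT p)) :=
        mul_smul_comm (β := ℂ) l Complex.I _
      have hk : J (k • oneT p) = k • J (oneT p) := mul_smul_comm (β := ℂ) k Complex.I _
      have ha : J (k • oneT p + l • J (oneT p)) = J (k • oneT p) + J (l • J (oneT p)) :=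
        mul_add (R := ℂ) Complex.I _ _
      rw [ha, hk, hl, J_J]
      module
    simp only [twoZero, hJ, map_add, map_smul, inner_add_left, inner_add_right,
      real_inner_smul_left, real_inner_smul_right, real_inner_self_eq_norm_sq, hxy, hyx, hx2, hy2]
    push_cast
    ring

end Pointwise

/-! ### Christoffel transforms: symmetry, conformality and uniqueness -/

section Transforms

variable {M : Type*} [TopologicalSpace M] [ChartedSpace ℂ M] {n : ℕ}

theorem wedge_dCl_eq_zero_iff {f h : M → E n} {p : M} :
    (∀ v w : T p, wedge (dCl f p) (dCl h p) v w = 0) ↔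
      ∀ v w : T p, inc (d f p v) * inc (d h p w) = inc (d f p w) * inc (d h p v) :=
  forall₂_congr fun _ _ => sub_eq_zero

theorem sandwich_dCl (a : E n) (f : M → E n) (p : M) (v : T p) :
    sandwich (inc a) (dCl f p) (inc a) v = inc (conj a (d f p v)) := by
  rw [inc_conj, mul_assoc]
  rfl

/-- Reversion is an anti-automorphism of the Clifford algebra that fixes vectors. This makes `α ∧ β
= 0` symmetric in `α` and `β`. -/
theorem inc_mul_eq_swap {a b x y : E n} (h : inc a * inc y = inc b * inc x) :
    inc y * inc a = inc x * inc b := by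
  simpa only [CliffordAlgebra.reverse.map_mul, CliffordAlgebra.reverse_ι]
    using congrArg CliffordAlgebra.reverse h

theorem inc_conj_mul_inc_conj_vinv {a : E n} (ha : a ≠ 0) (x y : E n) :
    inc (conj a x) * inc (conj (vinv a) y) = inc a * (inc x * inc y) * inc (vinv a) := by
  rw [inc_conj, inc_conj, mul_assoc (inc a * inc x), ← mul_assoc (inc a), ← mul_assoc (inc a),
    inc_mul_inc_vinv ha, one_mul]
  simp only [mul_assoc]

/-- `conj (vinv a)` is `‖a‖⁻⁴ conj a`, which cancels the factor `‖a‖⁴` of `conj a`. Hence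
`(2,0)`-parts are preserved. -/
theorem inner_conj_conj_vinv {a : E n} (ha : a ≠ 0) (x y : E n) :
    inner ℝ (conj a x) (conj (vinv a) y) = inner ℝ x y := by
  have h : ‖a‖ ≠ 0 := by simpa using ha
  rw [conj_vinv ha, real_inner_smul_right, inner_conj_conj, inv_mul_cancel_left₀ (by positivity)]

theorem IsChristoffelTransform.symm {Q : HolQuadDiff M} {f fc : M → E n} (hf : Smooth f)
    (h : IsChristoffelTransform Q f fc) : IsChristoffelTransform Q fc f where
  smooth := hf
  wedge_eq_zero p := wedge_dCl_eq_zero_iff.mpr fun v w =>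
    (inc_mul_eq_swap (wedge_dCl_eq_zero_iff.mp (h.wedge_eq_zero p) v w)).symm
  twoZero_eq p v w := by rw [twoZero_comm, h.twoZero_eq, Q.symm]

theorem IsChristoffelTransform.d_ne_zero {Q : HolQuadDiff M} {f fc : M → E n}
    (h : IsChristoffelTransform Q f fc) {p : M} (hp : Q.form p ≠ 0) : d fc p ≠ 0 := by
  intro h0
  refine hp ((Q.form_eq_zero_iff (one_ne_zero (α := ℂ))).mpr ?_)
  refine (h.twoZero_eq p (oneT p) (oneT p)).symm.trans ?_
  simp [twoZero, h0]

theorem IsIsothermic.isConformalImmersionOn {Q : HolQuadDiff M} {f fc : M → E n}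
    (h : IsIsothermic Q f fc) : IsConformalImmersionOn fc {p | Q.form p ≠ 0} := fun p hp =>
  conformal_of_wedge_eq_zero (h.conformal p trivial).1 (h.conformal p trivial).2
    (wedge_dCl_eq_zero_iff.mp (h.christoffel.wedge_eq_zero p)) (h.christoffel.d_ne_zero hp)

/-- The Christoffel transform of a map that is a conformal immersion on a dense set is unique up
to translation. -/
theorem IsChristoffelTransform.exists_eq_add_const [IsManifold 𝓘(ℂ, ℂ) ω M] [ConnectedSpace M]
    {Q : HolQuadDiff M} {f F G : M → E n} (hF : IsChristoffelTransform Q f F)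
    (hG : IsChristoffelTransform Q f G) {S : Set M} (hS : Dense S)
    (hf : IsConformalImmersionOn f S) : ∃ k, ∀ p, F p = G p + k := by
  obtain ⟨k, hk⟩ := (hF.smooth.sub hG.smooth).exists_eq_const hS fun p hp => by
    rw [d_sub hF.smooth hG.smooth]
    refine eq_zero_of_wedge_eq_zero (hf p hp).1 (hf p hp).2 (fun v w => ?_) ?_
    · have h1 := wedge_dCl_eq_zero_iff.mp (hF.wedge_eq_zero p) v w
      have h2 := wedge_dCl_eq_zero_iff.mp (hG.wedge_eq_zero p) v w
      simp only [sub_apply, map_sub, mul_sub, h1, h2]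
    · rw [twoZero_sub_right, hF.twoZero_eq, hG.twoZero_eq, sub_self]
  exact ⟨k, fun p => by rw [← hk p, add_sub_cancel]⟩

theorem exists_ne_of_d_ne_zero {f : M → E n} {p : M} (h : d f p ≠ 0) : ∃ p q : M, f p ≠ f q := by
  by_contra! hcon
  have : f = fun _ => f p := funext fun q => hcon q p
  rw [this] at h
  exact h (d_const _ _)

/-! ### Consequences of the Riccati equation -/

namespace IsDarbouxTransform

variable {r : ℝ} {f fc g : M → E n}

theorem d_apply (h : IsDarbouxTransform r f fc g) (p : M) (v : T p) :
    d g p v = r • conj (g p) (d fc p v) - d f p v := by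
  apply inc_injective
  rw [map_sub, map_smul, ← sandwich_dCl]
  exact LinearMap.congr_fun (h.riccati p) v

theorem d_add_apply (h : IsDarbouxTransform r f fc g) (hf : Smooth f) (p : M) (v : T p) :
    d (fun p => f p + g p) p v = r • conj (g p) (d fc p v) := by
  rw [d_add hf h.smooth, add_apply, h.d_apply, add_sub_cancel]

theorem smul_ne (h : IsDarbouxTransform r f fc g) (hr : r ≠ 0) (p : M) : r • g p ≠ 0 :=
  smul_ne_zero hr (h.ne p)

theorem smooth_vinv (h : IsDarbouxTransform r f fc g) (hr : r ≠ 0) :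
    Smooth (fun p => vinv (r • g p)) :=
  (h.smooth.const_smul r).vinv (h.smul_ne hr)

/-- Expanding `-(r g)⁻¹ (r dg) (r g)⁻¹` by the Riccati equation, the term in `dfc` loses its factors
`g` and the term in `df` acquires factors `g⁻¹`. -/
theorem d_vinv_apply (h : IsDarbouxTransform r f fc g) (hr : r ≠ 0) (p : M) (v : T p) :
    d (fun p => vinv (r • g p)) p v = r • conj (vinv (r • g p)) (d f p v) - d fc p v := by
  rw [d_vinv (h.smooth.const_smul r) (h.smul_ne hr p), d_const_smul h.smooth,
    smul_apply, h.d_apply, vinv_smul hr, conj_smul_left, conj_smul_left,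
    map_smul, map_sub, map_smul, conj_vinv_conj (h.ne p)]
  match_scalars <;> field_simp

/-- `fc + (r g)⁻¹` is a Darboux transform of `fc`. -/
theorem christoffel (h : IsDarbouxTransform r f fc g) (hr : r ≠ 0) :
    IsDarbouxTransform r fc f (fun p => vinv (r • g p)) where
  smooth := h.smooth_vinv hr
  ne p := vinv_ne_zero (h.smul_ne hr p)
  riccati p := by
    ext1 v
    rw [LinearMap.sub_apply, LinearMap.smul_apply, sandwich_dCl]
    change inc (d _ p v) = _ - inc (d fc p v)
    rw [h.d_vinv_apply hr, map_sub, map_smul]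

/-- A map with injective differential at some point forms a Darboux pair with its Darboux
transforms, when its Christoffel transform is not constant. -/
theorem isDarbouxPair (h : IsDarbouxTransform r f fc g) (hr : r ≠ 0) (hf : Smooth f)
    (hw : ∀ (p : M) (v w : T p), wedge (dCl f p) (dCl fc p) v w = 0) {p q : M}
    (hp : d f p ≠ 0) (hq : d fc q ≠ 0) : IsDarbouxPair f (fun p => f p + g p) where
  smooth_left := hf
  smooth_right := hf.add h.smooth
  nonconst_left := exists_ne_of_d_ne_zero hp
  nonconst_right := by
    refine exists_ne_of_d_ne_zero (p := q) fun h0 => hq ?_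
    ext1 v
    have h1 := h.d_add_apply hf q v
    rw [h0] at h1
    have h2 : conj (g q) (d fc q v) = 0 := (smul_eq_zero.mp h1.symm).resolve_left hr
    rw [← conj_vinv_conj (h.ne q) (d fc q v), h2, map_zero]
    rfl
  ne p := by rw [add_sub_cancel_left]; exact h.ne p
  wedge_eq_zero p v w := by
    -- Here `g⁻¹ d(f + g) g⁻¹ = r dfc`, so the Darboux condition is `r` times `df ∧ dfc = 0`.
    have key := wedge_dCl_eq_zero_iff.mp (hw p) v w
    rw [wedge, sandwich_dCl, sandwich_dCl, add_sub_cancel_left, h.d_add_apply hf,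
      h.d_add_apply hf, map_smul, map_smul, map_smul, map_smul, conj_vinv_conj (h.ne p),
      conj_vinv_conj (h.ne p), mul_smul_comm, mul_smul_comm]
    change r • (inc (d f p v) * _) - r • (inc (d f p w) * _) = 0
    rw [key, sub_self]

/-- `d(f + g) = r g dfc g` is `dfc` followed by a similarity, so conformality is inherited from `fc`
rather than from `f`. -/
theorem isConformalImmersionOn (h : IsDarbouxTransform r f fc g) (hr : r ≠ 0) (hf : Smooth f)
    {U : Set M} (hU : IsConformalImmersionOn fc U) :
    IsConformalImmersionOn (fun p => f p + g p) U := by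
  intro p hp
  obtain ⟨h1, h2⟩ := hU p hp
  constructor
  · intro v w hvw
    rw [h.d_add_apply hf, h.d_add_apply hf] at hvw
    apply h1
    rw [← conj_vinv_conj (h.ne p) (d fc p v), smul_right_injective _ hr hvw,
      conj_vinv_conj (h.ne p)]
  · intro v w
    have : twoZero (d (fun p => f p + g p) p) (d (fun p => f p + g p) p) v w
        = (r ^ 2 * ‖g p‖ ^ 4 : ℝ) * twoZero (d fc p) (d fc p) v w := by
      simp only [twoZero, h.d_add_apply hf, real_inner_smul_left, real_inner_smul_right,
        inner_conj_conj]
      push_cast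
      ring
    rw [this, h2, mul_zero]

theorem d_add_vinv_apply (h : IsDarbouxTransform r f fc g) (hr : r ≠ 0) (hfc : Smooth fc)
    (k : E n) (p : M) (v : T p) :
    d (fun p => fc p + vinv (r • g p) + k) p v = r⁻¹ • conj (vinv (g p)) (d f p v) := by
  have h' := h.christoffel hr
  rw [d_add (hfc.add h'.smooth) (smooth_const k), d_const, add_zero, h'.d_add_apply hfc,
    vinv_smul hr, conj_smul_left, smul_smul]
  congr 1
  field_simp

theorem isChristoffelTransform_add (h : IsDarbouxTransform r f fc g) (hr : r ≠ 0)
    {Q : HolQuadDiff M} (hf : Smooth f) (hc : IsChristoffelTransform Q f fc) (k : E n) :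
    IsChristoffelTransform Q (fun p => f p + g p) (fun p => fc p + vinv (r • g p) + k) where
  smooth := (hc.smooth.add (h.smooth_vinv hr)).add (smooth_const k)
  wedge_eq_zero p := wedge_dCl_eq_zero_iff.mpr fun v w => by
    have key := wedge_dCl_eq_zero_iff.mp ((hc.symm hf).wedge_eq_zero p) v w
    simp only [h.d_add_apply hf, h.d_add_vinv_apply hr hc.smooth, map_smul, smul_mul_smul_comm,
      inc_conj_mul_inc_conj_vinv (h.ne p), key]
  twoZero_eq p v w := by
    rw [← (hc.symm hf).twoZero_eq p v w]
    simp only [twoZero, h.d_add_apply hf, h.d_add_vinv_apply hr hc.smooth, real_inner_smul_left,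
      real_inner_smul_right, inner_conj_conj_vinv (h.ne p), inv_mul_cancel_left₀ hr]

end IsDarbouxTransform

end Transforms

end Isothermic

end

theorem mainTheorem5 {M : Type*} [TopologicalSpace M] [ChartedSpace ℂ M] [IsManifold 𝓘(ℂ, ℂ) ω M]
    [ConnectedSpace M] (Q : HolQuadDiff M) (hQ : ∃ p : M, Q.form p ≠ 0)
    {n : ℕ} (f fc : M → E n) (hf : IsIsothermic Q f fc)
    (r : ℝ) (hr : r ≠ 0) (g : M → E n) (hg : IsDarbouxTransform r f fc g) :
    -- away from the zeros of `Q`, the map `fc` is isothermic with Christoffel transform `f`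
    (IsConformalImmersionOn fc {p | Q.form p ≠ 0} ∧ IsChristoffelTransform Q fc f) ∧
    -- `fc + (r g)⁻¹` is a Darboux transform `𝓓_r fc`
    (IsDarbouxTransform r fc f (fun p => vinv (r • g p)) ∧
      IsDarbouxPair fc (fun p => fc p + vinv (r • g p))) ∧
    -- away from the zeros of `Q`, the map `f + g` is a conformal immersion
    IsConformalImmersionOn (fun p => f p + g p) {p | Q.form p ≠ 0} ∧
    -- the Christoffel transforms of `f + g` are the translates of `fc + (r g)⁻¹`
    (∀ F : M → E n, IsChristoffelTransform Q (fun p => f p + g p) F ↔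
      ∃ k : E n, ∀ p, F p = fc p + vinv (r • g p) + k) ∧
    -- and they have the differential `r⁻¹ g⁻¹ df g⁻¹`
    (∀ F : M → E n, IsChristoffelTransform Q (fun p => f p + g p) F →
      ∀ p, dCl F p = r⁻¹ • sandwich (inc (vinv (g p))) (dCl f p) (inc (vinv (g p)))) := by
  have hfc := hf.isConformalImmersionOn
  have hsymm := hf.christoffel.symm hf.smooth
  have hg' := hg.christoffel hr
  have hconf := hg.isConformalImmersionOn hr hf.smooth hfc
  have hiff : ∀ F : M → E n, IsChristoffelTransform Q (fun p => f p + g p) F ↔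
      ∃ k : E n, ∀ p, F p = fc p + vinv (r • g p) + k := by
    refine fun F => ⟨fun hF => ?_, fun ⟨k, hk⟩ => ?_⟩
    · obtain ⟨k, hk⟩ := hF.exists_eq_add_const
        (hg.isChristoffelTransform_add hr hf.smooth hf.christoffel 0) (Q.dense_ne_zero hQ) hconf
      exact ⟨k, fun p => by rw [hk p, add_zero]⟩
    · rw [show F = _ from funext hk]
      exact hg.isChristoffelTransform_add hr hf.smooth hf.christoffel k
  refine ⟨⟨hfc, hsymm⟩, ⟨hg', ?_⟩, hconf, hiff, fun F hF p => ?_⟩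
  -- At a point where `Q ≠ 0`, neither `df` nor `dfc` vanishes, so both maps of the pair are
  -- non-constant.
  · obtain ⟨p, hp⟩ := hQ
    exact hg'.isDarbouxPair hr hf.christoffel.smooth hsymm.wedge_eq_zero
      (hf.christoffel.d_ne_zero hp) (hsymm.d_ne_zero hp)
  · obtain ⟨k, hk⟩ := (hiff F).mp hF
    ext1 v
    rw [LinearMap.smul_apply, sandwich_dCl]
    change inc (d F p v) = _
    rw [show F = _ from funext hk, hg.d_add_vinv_apply hr hf.christoffel.smooth, map_smul]
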